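/- Let $N\ge 1$ and let $\Omega\subset\mathbb{R}^N$ be a bounded open set. For $p>N$ let $\lambda_p$ be the smallest eigenvalue of the $p$-Laplacian on $\Omega$, i.e. the smallest real $\lambda$ for which $-\mathrm{div}(|\nabla u|^{p-2}\nabla u)=\lambda|u|^{p-2}u$ has a nonzero distributional solution $u\in W_0^{1,p}(\Omega)$, and let $u_p$ be an eigenfunction for $\lambda_p$, continuous on $\overline\Omega$, positive in $\Omega$ and normalised by $\int_\Omega u_p^p\,dx=1$. Put $f_p=u_p^{p-1}\,dx$. Let $(\Lambda_\infty,u_\infty,f_\infty)$ be limits of these objects along a sequence of exponents $p_k\to\infty$, $p_k>N$: $\lambda_{p_k}^{1/p_k}\to\Lambda_\infty$, $u_{p_k}\to u_\infty$ uniformly on $\overline\Omega$, and $f_{p_k}\rightharpoonup f_\infty$ weakly* in the space of finite Borel measures on $\overline\Omega$. Denote by $\mathscr P(\partial\Omega)$ the set of Borel probability measures concentrated on $\partial\Omega$, by $(\mathcal P_\infty)$ the problem $$\min\Big\{-\int_{\overline\Omega} u\,df_\infty:\ u\in \mathrm{Lip}(\Omega),\ |\nabla u|\le\Lambda_\infty\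 \text{a.e. in }\Omega,\ u=0\ \text{on }\partial\Omega\Big\},$$ and by $(\mathcal P_\infty^*)$ the problem $$\min\Big\{\Lambda_\infty\int_{\mathbb{R}^N}|\sigma|:\ \nu\in\mathscr P(\partial\Omega),\ \sigma\ \text{a bounded } \mathbb{R}^N\text{-valued Borel measure on }\mathbb{R}^N,\ -\mathrm{div}\,\sigma=f_\infty-\nu\ \text{in }\mathbb{R}^N\Big\},$$ where $|\sigma|$ is the total variation measure of $\sigma$ and the divergence equation means $\int\nabla\varphi\cdot d\sigma=\int\varphi\,df_\infty-\int\varphi\,d\nu$ for all $\varphi\in C_c^\infty(\mathbb{R}^N)$. Then $\Lambda_\infty>0$, both minima are attained, and $$\inf\Big\{\int_{\overline\Omega\times\overline\Omega}|x-y|\,d\gamma:\ \pi^1_\sharp\gamma=f_\infty,\ \pi^2_\sharp\gamma\in\mathscr P(\partial\Omega)\Big\}=-\frac1{\Lambda_\infty}\min(\mathcal P_\infty)=\frac1{\Lambda_\infty}\min(\mathcal P_\infty^*),$$ where the infimum is over Borel measures $\gamma$ on $\mathbb{R}^N\times\mathbb{R}^N$ with marginals $\pi^1_\sharp\gamma$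 and $\pi^2_\sharp\gamma$ (so that $\gamma$ is concentrated on $\overline\Omega\times\overline\Omega$). -/

import Mathlib

open MeasureTheory Filter Topology Set
open scoped ENNReal ContDiff

namespace InftyEigenvalue

/-- Euclidean space `ℝ^N`. -/
abbrev Euc (N : ℕ) : Type := EuclideanSpace ℝ (Fin N)

variable {N : ℕ}

/-- `φ ∈ C_c^∞(Ω)`: smooth functions on `ℝ^N` whose support is a compact subset of `Ω`. -/
def IsTestFunction (Ω : Set (Euc N)) (φ : Euc N → ℝ) : Prop :=
  ContDiff ℝ ∞ φ ∧ HasCompactSupport φ ∧ tsupport φ ⊆ Ω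

/-- `u ∈ W_0^{1,p}(Ω)` with weak gradient `G`: the pair `(u, G)` is a limit in
`L^p(Ω) × L^p(Ω; ℝ^N)` of pairs `(φ_n, ∇φ_n)` with `φ_n ∈ C_c^∞(Ω)`. -/
def MemW0WithGrad (Ω : Set (Euc N)) (p : ℝ) (u : Euc N → ℝ) (G : Euc N → Euc N) : Prop :=
  MemLp u (ENNReal.ofReal p) (volume.restrict Ω) ∧
  MemLp G (ENNReal.ofReal p) (volume.restrict Ω) ∧
  ∃ φ : ℕ → Euc N → ℝ, (∀ n, IsTestFunction Ω (φ n)) ∧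
    Tendsto (fun n => eLpNorm (fun x => φ n x - u x) (ENNReal.ofReal p) (volume.restrict Ω))
      atTop (𝓝 0) ∧
    Tendsto (fun n => eLpNorm (fun x => gradient (φ n) x - G x) (ENNReal.ofReal p)
      (volume.restrict Ω)) atTop (𝓝 0)

/-- `u ∈ W_0^{1,p}(Ω)` solves `-div(|∇u|^{p-2} ∇u) = lam |u|^{p-2} u` in `Ω` in the sense of
distributions. -/
def SolvesPLaplace (Ω : Set (Euc N)) (p lam : ℝ) (u : Euc N → ℝ) : Prop :=
  ∃ G : Euc N → Euc N, MemW0WithGrad Ω p u G ∧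
    ∀ φ : Euc N → ℝ, IsTestFunction Ω φ →
      ∫ x in Ω, ‖G x‖ ^ (p - 2) * inner ℝ (G x) (gradient φ x) =
        lam * ∫ x in Ω, |u x| ^ (p - 2) * u x * φ x

/-- `lam` is an eigenvalue of the `p`-Laplacian on `Ω` (with zero Dirichlet condition). -/
def IsEigenvalue (Ω : Set (Euc N)) (p lam : ℝ) : Prop :=
  ∃ u : Euc N → ℝ, SolvesPLaplace Ω p lam u ∧ ¬ (u =ᵐ[volume.restrict Ω] 0)

/-- The first (smallest) eigenvalue `λ_p` of the `p`-Laplacian on `Ω`. -/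
noncomputable def firstEigenvalue (Ω : Set (Euc N)) (p : ℝ) : ℝ :=
  sInf {lam : ℝ | IsEigenvalue Ω p lam}

/-- `u` is (the continuous representative of) a positive eigenfunction for the first eigenvalue,
normalised in `L^p(Ω)`; here `p > N`, so that elements of `W_0^{1,p}(Ω)` are continuous on
the closure of `Ω`. -/
def IsFirstEigenfunction (Ω : Set (Euc N)) (p : ℝ) (u : Euc N → ℝ) : Prop :=
  SolvesPLaplace Ω p (firstEigenvalue Ω p) u ∧
  ContinuousOn u (closure Ω) ∧ (∀ x ∈ Ω, 0 < u x) ∧ ∫ x in Ω, u x ^ p = 1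

/-- `(Lam, uinf, f)` is a limit `(Λ_∞, u_∞, f_∞)` obtained along a sequence of exponents
`p_k → ∞`, `p_k > N`, with `u k` the normalised positive first eigenfunction for `p k`:
`λ_{p_k}^{1/p_k} → Λ_∞`, `u_{p_k} → u_∞` uniformly on the closure of `Ω`, and
`f_{p_k} = u_{p_k}^{p_k - 1} dx` converges weakly* to `f_∞` in the space of finite measures on the
closure of `Ω` (that `f_∞` has mass one and that `Λ_∞ > 0` is not part of the definition). -/
structure IsLimit (Ω : Set (Euc N)) (p : ℕ → ℝ) (u : ℕ → Euc N → ℝ)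
    (Lam : ℝ) (uinf : Euc N → ℝ) (f : Measure (Euc N)) : Prop where
  dim_lt : ∀ k, (N : ℝ) < p k
  exponent_tendsto : Tendsto p atTop atTop
  eigenfunction : ∀ k, IsFirstEigenfunction Ω (p k) (u k)
  eigenvalue_tendsto : Tendsto (fun k => firstEigenvalue Ω (p k) ^ (1 / p k)) atTop (𝓝 Lam)
  uniform_tendsto : TendstoUniformlyOn u uinf atTop (closure Ω)
  finite : IsFiniteMeasure f
  concentrated : f (closure Ω)ᶜ = 0
  weak_tendsto : ∀ φ : Euc N → ℝ, Continuous φ →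
    Tendsto (fun k => ∫ x in Ω, φ x * u k x ^ (p k - 1)) atTop (𝓝 (∫ x, φ x ∂f))

/-- The set `𝒫(S)` of Borel probability measures concentrated on `S`. -/
def ProbOn (S : Set (Euc N)) : Set (Measure (Euc N)) :=
  {ν | IsProbabilityMeasure ν ∧ ν Sᶜ = 0}

/-- The values `∫ |x - y| dγ` over all transport plans `γ` from `f` to
some probability measure on the boundary of `Ω`. -/
def kantorovichValues (Ω : Set (Euc N)) (f : Measure (Euc N)) : Set ℝ :=
  {r | ∃ γ : Measure (Euc N × Euc N),
    γ.map Prod.fst = f ∧ γ.map Prod.snd ∈ ProbOn (frontier Ω) ∧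
    r = ∫ z in closure Ω ×ˢ closure Ω, ‖z.1 - z.2‖ ∂γ}

/-- Admissible functions of `(P_∞)`: `u ∈ Lip(Ω)` (given with its values on the closure),
`|∇u| ≤ Lam` a.e. in `Ω`, `u = 0` on the boundary. -/
def IsAdmissible (Ω : Set (Euc N)) (Lam : ℝ) (u : Euc N → ℝ) : Prop :=
  (∃ K, LipschitzOnWith K u (closure Ω)) ∧
  (∀ᵐ x ∂(volume.restrict Ω), ‖gradient u x‖ ≤ Lam) ∧
  ∀ x ∈ frontier Ω, u x = 0

/-- The values of the objective `-⟨f, u⟩` of `(P_∞)`. -/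
def primalValues (Ω : Set (Euc N)) (Lam : ℝ) (f : Measure (Euc N)) : Set ℝ :=
  {r | ∃ u : Euc N → ℝ, IsAdmissible Ω Lam u ∧ r = -∫ x in closure Ω, u x ∂f}

/-- `-div σ = f - ν` in `ℝ^N` in the sense of distributions: `∫ ∇φ · dσ = ∫ φ d(f - ν)` for all
`φ ∈ C_c^∞(ℝ^N)`. -/
def NegDivEq (σ : VectorMeasure (Euc N) (Euc N)) (f ν : Measure (Euc N)) : Prop :=
  ∀ φ : Euc N → ℝ, IsTestFunction univ φ →
    σ.integral (fun x => gradient φ x) (innerSL ℝ) = ∫ x, φ x ∂f - ∫ x, φ x ∂ν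

/-- The values of the objective `Lam ∫ |σ|` of `(P_∞^*)`, over `ν ∈ 𝒫(∂Ω)` and bounded
`ℝ^N`-valued measures `σ` with `-div σ = f - ν` in `ℝ^N`. -/
def dualValues (Ω : Set (Euc N)) (Lam : ℝ) (f : Measure (Euc N)) : Set ℝ :=
  {r | ∃ ν ∈ ProbOn (frontier Ω), ∃ σ : VectorMeasure (Euc N) (Euc N),
    σ.variation univ ≠ ⊤ ∧ NegDivEq σ f ν ∧ r = Lam * (σ.variation univ).toReal}

end InftyEigenvalue

namespace InftyEigenvalue

variable {N : ℕ}

/-! Let d(x) be the distance from x to the complement of Ω and put I = ∫ d df. All three problems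
are solved explicitly: the Kantorovich infimum is I, the primal minimum is -ΛI and the dual minimum
is ΛI.

An admissible u satisfies |u| ≤ Λd (`IsAdmissible.abs_le`), and Λd is admissible, which settles the
primal problem. For transport, |x - y| ≥ d(x) whenever y lies on the boundary, with equality for the
plan given by a measurable nearest-point map T (`exists_measurable_nearest`). For the dual, testing
the divergence equation with a mollified d bounds the mass of σ below by I
(`NegDivEq.sub_le_variation`), and `rayMeasure`, carried by the segments [x, T x], attains the
bound.

The eigenvalue problem enters only through three facts: Ω is nonempty, f has mass one, and Λ > 0.
Mass one follows by comparing u_p^{p-1} with u_p^p; positivity of Λ follows from a Poincaré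
inequality whose constant does not depend on p. -/

/-! ### The limit measure has mass one. -/

lemma IsLimit.continuousOn_limit {Ω : Set (Euc N)} {p : ℕ → ℝ} {u : ℕ → Euc N → ℝ} {Lam : ℝ}
    {uinf : Euc N → ℝ} {f : Measure (Euc N)} (h : IsLimit Ω p u Lam uinf f) :
    ContinuousOn uinf (closure Ω) :=
  h.uniform_tendsto.continuousOn (Frequently.of_forall fun k => (h.eigenfunction k).2.1)

/-- The Bochner integral of a non-integrable function is 0, so the normalisation already contains
integrability. -/
lemma IsFirstEigenfunction.integrable_rpow {Ω : Set (Euc N)} {p : ℝ} {u : Euc N → ℝ}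
    (h : IsFirstEigenfunction Ω p u) : Integrable (fun x => u x ^ p) (volume.restrict Ω) :=
  Integrable.of_integral_ne_zero (by rw [h.2.2.2]; exact one_ne_zero)

/-- Uniform limits of functions with unit `L^p` norms, `p → ∞`, are bounded by one. -/
lemma IsLimit.limit_le_one {Ω : Set (Euc N)} (hΩ : IsOpen Ω) (hΩb : Bornology.IsBounded Ω)
    {p : ℕ → ℝ} {u : ℕ → Euc N → ℝ} {Lam : ℝ}
    {uinf : Euc N → ℝ} {f : Measure (Euc N)} (h : IsLimit Ω p u Lam uinf f) :
    ∀ x ∈ closure Ω, uinf x ≤ 1 := by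
  intro x₀ hx₀
  by_contra! hlt
  obtain ⟨ε, hε, hε'⟩ : ∃ ε > 0, 1 + 2 * ε < uinf x₀ :=
    ⟨(uinf x₀ - 1) / 4, by linarith, by linarith⟩
  set U : Set (Euc N) := Ω ∩ uinf ⁻¹' Ioi (1 + 2 * ε) with hU
  have hUo : IsOpen U :=
    (h.continuousOn_limit.mono subset_closure).isOpen_inter_preimage hΩ isOpen_Ioi
  have hUne : U.Nonempty := by
    have hc : Tendsto uinf (𝓝[Ω] x₀) (𝓝 (uinf x₀)) :=
      (h.continuousOn_limit x₀ hx₀).mono_left (nhdsWithin_mono _ subset_closure)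
    have := mem_closure_iff_nhdsWithin_neBot.1 hx₀
    obtain ⟨x, hx⟩ := ((hc.eventually (lt_mem_nhds hε')).and self_mem_nhdsWithin).exists
    exact ⟨x, hx.2, hx.1⟩
  have hUΩ : U ⊆ Ω := inter_subset_left
  have hUfin : volume U ≠ ⊤ := (hΩb.subset hUΩ).measure_lt_top.ne
  have hUpos : 0 < volume.real U := ENNReal.toReal_pos (hUo.measure_pos _ hUne).ne' hUfin
  -- On U, uniform convergence gives u_k ≥ 1 + ε for large k, and Bernoulli's inequality turns this
  -- into u_k^p ≥ pε. The normalisation then bounds |U| p_k ε by 1, although p_k → ∞.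
  have key : ∀ᶠ k in atTop, volume.real U * (p k * ε) ≤ 1 := by
    have h1 := (Metric.tendstoUniformlyOn_iff.1 h.uniform_tendsto) ε hε
    filter_upwards [h1, h.exponent_tendsto.eventually_ge_atTop 1] with k hk hpk
    have hint := (h.eigenfunction k).integrable_rpow
    have hbound : ∀ x ∈ U, p k * ε ≤ u k x ^ p k := by
      intro x hx
      have h2 := hk x (subset_closure (hUΩ hx))
      have h3 : 1 + 2 * ε < uinf x := hx.2
      rw [Real.dist_eq] at h2
      have h4 : 1 + ε ≤ u k x := by linarith [(abs_lt.1 h2).2]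
      calc p k * ε ≤ 1 + p k * ε := by linarith
        _ ≤ (1 + ε) ^ p k := one_add_mul_self_le_rpow_one_add (by linarith) hpk
        _ ≤ u k x ^ p k := Real.rpow_le_rpow (by linarith) h4 (by linarith)
    calc volume.real U * (p k * ε) = ∫ _ in U, p k * ε := by simp
      _ ≤ ∫ x in U, u k x ^ p k :=
        setIntegral_mono_on (integrableOn_const hUfin) (hint.mono_measure
          (Measure.restrict_mono hUΩ le_rfl)) hUo.measurableSet hbound
      _ ≤ ∫ x in Ω, u k x ^ p k := setIntegral_mono_set hint
          ((ae_restrict_iff' hΩ.measurableSet).2 (ae_of_all _ fun x hx =>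
            Real.rpow_nonneg ((h.eigenfunction k).2.2.1 x hx).le _))
          hUΩ.eventuallyLE
      _ = 1 := (h.eigenfunction k).2.2.2
  have ht : Tendsto (fun k => volume.real U * (p k * ε)) atTop atTop :=
    (h.exponent_tendsto.atTop_mul_const hε).const_mul_atTop hUpos
  obtain ⟨k, hk1, hk2⟩ := (key.and (ht.eventually_gt_atTop 1)).exists
  linarith

/-- The weak limit of the densities `u_p^{p-1}` has mass one. -/
lemma IsLimit.isProbabilityMeasure {Ω : Set (Euc N)} (hΩ : IsOpen Ω)
    (hΩb : Bornology.IsBounded Ω) {p : ℕ → ℝ} {u : ℕ → Euc N → ℝ} {Lam : ℝ}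
    {uinf : Euc N → ℝ} {f : Measure (Euc N)} (h : IsLimit Ω p u Lam uinf f) :
    IsProbabilityMeasure f := by
  have := h.finite
  have hΩfin : volume Ω ≠ ⊤ := hΩb.measure_lt_top.ne
  have : IsFiniteMeasure (volume.restrict Ω) := ⟨by simpa using hΩfin.lt_top⟩
  have hlim : Tendsto (fun k => ∫ x in Ω, u k x ^ (p k - 1)) atTop (𝓝 (f.real univ)) := by
    simpa using h.weak_tendsto (fun _ => 1) continuous_const
  -- Weighted AM-GM for u^p and 1. After integration the bound is 1 + (|Ω| - 1)/p, which tends to 1.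
  have young : ∀ k, 1 ≤ p k → ∀ x ∈ Ω,
      u k x ^ (p k - 1) ≤ (p k - 1) / p k * u k x ^ p k + 1 / p k := by
    intro k hpk x hx
    have hu := (h.eigenfunction k).2.2.1 x hx
    have h0 : 0 < p k := by linarith
    have := Real.geom_mean_le_arith_mean2_weighted (w₁ := (p k - 1) / p k) (w₂ := 1 / p k)
      (p₁ := u k x ^ p k) (p₂ := 1) (div_nonneg (by linarith) h0.le) (by positivity)
      (Real.rpow_nonneg hu.le _) zero_le_one (by field_simp; ring)
    rwa [← Real.rpow_mul hu.le, mul_div_cancel₀ _ h0.ne', Real.one_rpow, mul_one, mul_one] at this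
  have hint : ∀ k, 1 ≤ p k → Integrable (fun x => u k x ^ (p k - 1)) (volume.restrict Ω) := by
    intro k hpk
    have hi := (((h.eigenfunction k).integrable_rpow).const_mul ((p k - 1) / p k)).add
      (integrable_const (1 / p k))
    refine hi.mono' ?_ ?_
    · refine ContinuousOn.aestronglyMeasurable ?_ hΩ.measurableSet
      exact ((h.eigenfunction k).2.1.mono subset_closure).rpow_const fun x hx =>
        Or.inl ((h.eigenfunction k).2.2.1 x hx).ne'
    · refine (ae_restrict_iff' hΩ.measurableSet).2 (ae_of_all _ fun x hx => ?_)
      rw [Real.norm_of_nonneg (Real.rpow_nonneg ((h.eigenfunction k).2.2.1 x hx).le _)]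
      exact young k hpk x hx
  have hupper : f.real univ ≤ 1 := by
    have hinv : Tendsto (fun k => (p k)⁻¹) atTop (𝓝 0) :=
      tendsto_inv_atTop_zero.comp h.exponent_tendsto
    have hR : Tendsto (fun k => 1 + (p k)⁻¹ * (volume.real Ω - 1)) atTop (𝓝 1) := by
      simpa using (hinv.mul_const (volume.real Ω - 1)).const_add 1
    refine le_of_tendsto_of_tendsto hlim hR ?_
    filter_upwards [h.exponent_tendsto.eventually_ge_atTop 1] with k hpk
    have h0 : 0 < p k := by linarith
    calc ∫ x in Ω, u k x ^ (p k - 1)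
        ≤ ∫ x in Ω, ((p k - 1) / p k * u k x ^ p k + 1 / p k) :=
          setIntegral_mono_on (hint k hpk) ((((h.eigenfunction k).integrable_rpow).const_mul
            ((p k - 1) / p k)).add (integrable_const (1 / p k))) hΩ.measurableSet (young k hpk)
      _ = 1 + (p k)⁻¹ * (volume.real Ω - 1) := by
          rw [integral_add (((h.eigenfunction k).integrable_rpow).const_mul _)
            (integrable_const _), integral_const_mul, (h.eigenfunction k).2.2.2]
          simp
          field_simp
          ring
  -- Since u_∞ ≤ 1, eventually u_k ≤ 1 + ε, hence 1 = ∫ u_k^p ≤ (1 + ε) ∫ u_k^{p-1}.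
  have hlower : 1 ≤ f.real univ := by
    refine le_of_forall_pos_le_add fun ε hε => ?_
    have hM : f.real univ * (1 + ε) ≤ f.real univ + ε := by nlinarith
    refine le_trans ?_ hM
    refine ge_of_tendsto (hlim.mul_const (1 + ε)) ?_
    have h1 := (Metric.tendstoUniformlyOn_iff.1 h.uniform_tendsto) ε hε
    filter_upwards [h1, h.exponent_tendsto.eventually_ge_atTop 1] with k hk hpk
    refine (h.eigenfunction k).2.2.2.symm.le.trans ?_
    rw [← integral_mul_const]
    refine setIntegral_mono_on (h.eigenfunction k).integrable_rpow ((hint k hpk).mul_const _)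
      hΩ.measurableSet fun x hx => ?_
    have hu := (h.eigenfunction k).2.2.1 x hx
    have h2 := hk x (subset_closure hx)
    have h3 := h.limit_le_one hΩ hΩb x (subset_closure hx)
    rw [Real.dist_eq] at h2
    have h4 : u k x ≤ 1 + ε := by linarith [(abs_lt.1 h2).1]
    calc u k x ^ p k = u k x ^ (p k - 1) * u k x := by
          rw [← Real.rpow_add_one hu.ne']; ring_nf
      _ ≤ u k x ^ (p k - 1) * (1 + ε) := by
          gcongr
  refine ⟨?_⟩
  have h1 : f.real univ = 1 := le_antisymm hupper hlower
  rw [Measure.real, ENNReal.toReal_eq_one_iff] at h1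
  exact h1

/-! ### Hölder pairings and gradients of test functions. -/

section Holder

variable {α V : Type*} [MeasurableSpace α] {μ : Measure α} [NormedAddCommGroup V]
  [InnerProductSpace ℝ V] {p q : ℝ≥0∞}

lemma eLpNorm_inner_le [q.HolderTriple p 1] {H ψ : α → V} (hH : AEStronglyMeasurable H μ)
    (hψ : AEStronglyMeasurable ψ μ) :
    eLpNorm (fun x => inner ℝ (H x) (ψ x)) 1 μ ≤ eLpNorm H q μ * eLpNorm ψ p μ := by
  simpa using eLpNorm_le_eLpNorm_mul_eLpNorm'_of_norm (p := q) (q := p) (r := 1) hH hψ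
    (fun a b => inner ℝ a b) 1 (ae_of_all _ fun x => by simpa using norm_inner_le_norm (𝕜 := ℝ) _ _)

lemma integrable_inner_of_memLp [q.HolderTriple p 1] {H ψ : α → V} (hH : MemLp H q μ)
    (hψ : MemLp ψ p μ) : Integrable (fun x => inner ℝ (H x) (ψ x)) μ := by
  rw [← memLp_one_iff_integrable]
  exact ⟨hH.1.inner hψ.1, (eLpNorm_inner_le (p := p) (q := q) hH.1 hψ.1).trans_lt
    (ENNReal.mul_lt_top hH.2 hψ.2)⟩

/-- Pairing with a fixed L^q field is continuous on L^p; this carries identities from test functions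
to W_0^{1,p}. -/
lemma tendsto_integral_inner [q.HolderTriple p 1] {H ψ : α → V} {φ : ℕ → α → V}
    (hH : MemLp H q μ) (hψ : MemLp ψ p μ) (hφ : ∀ n, MemLp (φ n) p μ)
    (h : Tendsto (fun n => eLpNorm (fun x => φ n x - ψ x) p μ) atTop (𝓝 0)) :
    Tendsto (fun n => ∫ x, inner ℝ (H x) (φ n x) ∂μ) atTop (𝓝 (∫ x, inner ℝ (H x) (ψ x) ∂μ)) := by
  refine tendsto_integral_of_L1' _ (hH.1.inner hψ.1)
    (Eventually.of_forall fun n => integrable_inner_of_memLp hH (hφ n)) ?_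
  have h0 : Tendsto (fun n => eLpNorm H q μ * eLpNorm (fun x => φ n x - ψ x) p μ) atTop (𝓝 0) := by
    simpa using ENNReal.Tendsto.const_mul h (Or.inr hH.2.ne)
  refine tendsto_of_tendsto_of_tendsto_of_le_of_le tendsto_const_nhds h0 (fun _ => zero_le)
    fun n => ?_
  have := eLpNorm_inner_le (p := p) (q := q) hH.1 ((hφ n).1.sub hψ.1)
  simpa [Pi.sub_def, inner_sub_right] using this

end Holder

section Gradient

lemma IsTestFunction.continuous_gradient {Ω : Set (Euc N)} {φ : Euc N → ℝ}
    (h : IsTestFunction Ω φ) : Continuous (fun x => gradient φ x) :=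
  (LinearIsometryEquiv.continuous _).comp (h.1.continuous_fderiv (by simp))

lemma norm_gradient (φ : Euc N → ℝ) (x : Euc N) : ‖gradient φ x‖ = ‖fderiv ℝ φ x‖ :=
  LinearIsometryEquiv.norm_map _ _

lemma IsTestFunction.hasCompactSupport_gradient {Ω : Set (Euc N)} {φ : Euc N → ℝ}
    (h : IsTestFunction Ω φ) : HasCompactSupport (fun x => gradient φ x) :=
  (h.2.1.fderiv ℝ).comp_left (g := (InnerProductSpace.toDual ℝ (Euc N)).symm) (map_zero _)

lemma IsTestFunction.support_gradient_subset {Ω : Set (Euc N)} {φ : Euc N → ℝ}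
    (h : IsTestFunction Ω φ) : Function.support (fun x => gradient φ x) ⊆ Ω := by
  intro x hx
  refine h.2.2 (support_fderiv_subset ℝ (f := φ) ?_)
  rw [Function.mem_support, ← norm_ne_zero_iff] at hx ⊢
  rwa [← norm_gradient]

lemma IsTestFunction.memLp {Ω : Set (Euc N)} {φ : Euc N → ℝ} (h : IsTestFunction Ω φ)
    (p : ℝ≥0∞) (μ : Measure (Euc N)) [IsFiniteMeasureOnCompacts μ] : MemLp φ p μ :=
  h.1.continuous.memLp_of_hasCompactSupport h.2.1

lemma IsTestFunction.memLp_gradient {Ω : Set (Euc N)} {φ : Euc N → ℝ} (h : IsTestFunction Ω φ)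
    (p : ℝ≥0∞) (μ : Measure (Euc N)) [IsFiniteMeasureOnCompacts μ] :
    MemLp (fun x => gradient φ x) p μ :=
  h.continuous_gradient.memLp_of_hasCompactSupport h.hasCompactSupport_gradient

end Gradient

/-! ### Poincaré inequality with a constant independent of p. -/

section Poincare

/-- Along a segment of a unit direction `e` that leaves the support, a test function is bounded by
the integral of its gradient. -/
lemma IsTestFunction.enorm_le_lintegral_gradient {Ω : Set (Euc N)} {φ : Euc N → ℝ}
    (h : IsTestFunction Ω φ) {e x : Euc N} (he : ‖e‖ = 1) {T : ℝ} (hT : 0 ≤ T)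
    (hout : x + T • e ∉ Ω) :
    ‖φ x‖ₑ ≤ ∫⁻ t in Ioc 0 T, ‖gradient φ (x + t • e)‖ₑ := by
  have hder : ∀ t : ℝ, HasDerivAt (fun t : ℝ => φ (x + t • e))
      (inner ℝ (gradient φ (x + t • e)) e) t := by
    intro t
    rw [inner_gradient_left]
    have h1 : HasDerivAt (fun t : ℝ => x + t • e) e t := by
      simpa using ((hasDerivAt_id t).smul_const e).const_add x
    exact ((h.1.differentiable (by simp)) (x + t • e)).hasFDerivAt.comp_hasDerivAt t h1
  have hcont : Continuous fun t : ℝ => inner ℝ (gradient φ (x + t • e)) e :=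
    (h.continuous_gradient.comp (by fun_prop)).inner continuous_const
  have hftc := intervalIntegral.integral_eq_sub_of_hasDerivAt (a := 0) (b := T)
    (fun t _ => hder t) (hcont.intervalIntegrable _ _)
  have hz : φ (x + T • e) = 0 := image_eq_zero_of_notMem_tsupport fun hx => hout (h.2.2 hx)
  simp only [hz, zero_smul, add_zero, zero_sub] at hftc
  rw [← enorm_neg, ← hftc, intervalIntegral.integral_of_le hT]
  refine (enorm_integral_le_lintegral_enorm _).trans (lintegral_mono fun t => ?_)
  rw [← ofReal_norm, ← ofReal_norm]
  refine ENNReal.ofReal_le_ofReal ((norm_inner_le_norm _ _).trans ?_)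
  rw [he, mul_one]

/-- The Poincaré inequality in `L^p` with a constant that does not depend on `p`. -/
lemma IsTestFunction.eLpNorm_le_eLpNorm_gradient {Ω : Set (Euc N)} {φ : Euc N → ℝ}
    (h : IsTestFunction Ω φ) {e : Euc N} (he : ‖e‖ = 1) {T : ℝ} (hT : 0 ≤ T)
    (hout : ∀ x ∈ Ω, x + T • e ∉ Ω) {p : ℝ} (hp : 1 ≤ p) :
    eLpNorm φ (ENNReal.ofReal p) volume ≤
      ENNReal.ofReal T * eLpNorm (fun x => gradient φ x) (ENNReal.ofReal p) volume := by
  have hp0 : 0 < p := by linarith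
  have hpr : (ENNReal.ofReal p).toReal = p := ENNReal.toReal_ofReal hp0.le
  have hne : ENNReal.ofReal p ≠ 0 := by simpa using hp0
  have hmeas : Measurable fun z : Euc N × ℝ => ‖gradient φ (z.1 + z.2 • e)‖ₑ ^ p :=
    ((h.continuous_gradient.comp (by fun_prop : Continuous fun z : Euc N × ℝ =>
      z.1 + z.2 • e)).measurable.enorm).pow_const p
  have hpt : ∀ x, ‖φ x‖ₑ ^ p ≤
      ENNReal.ofReal T ^ (p - 1) * ∫⁻ t in Ioc 0 T, ‖gradient φ (x + t • e)‖ₑ ^ p := by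
    intro x
    by_cases hx : x ∈ Ω
    · have h1 := h.enorm_le_lintegral_gradient he hT (hout x hx)
      -- Hölder on (0, T], comparing the L^1 and L^p norms at the cost of a factor T^{1 - 1/p}.
      have h2 := eLpNorm_le_eLpNorm_mul_rpow_measure_univ (p := 1) (q := ENNReal.ofReal p)
        (μ := volume.restrict (Ioc 0 T)) (f := fun t : ℝ => gradient φ (x + t • e))
        (by simpa using hp)
        (h.continuous_gradient.comp (by fun_prop)).aestronglyMeasurable
      rw [eLpNorm_one_eq_lintegral_enorm, eLpNorm_eq_lintegral_rpow_enorm_toReal hne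
        ENNReal.ofReal_ne_top, hpr] at h2
      simp only [Measure.restrict_apply_univ, Real.volume_Ioc, sub_zero, ENNReal.toReal_one,
        div_one] at h2
      calc ‖φ x‖ₑ ^ p ≤ ((∫⁻ t in Ioc 0 T, ‖gradient φ (x + t • e)‖ₑ ^ p) ^ (1 / p) *
            ENNReal.ofReal T ^ (1 - 1 / p)) ^ p := by
            gcongr
            exact h1.trans h2
        _ = _ := by
            rw [ENNReal.mul_rpow_of_nonneg _ _ hp0.le, ← ENNReal.rpow_mul, ← ENNReal.rpow_mul,
              one_div_mul_cancel hp0.ne', ENNReal.rpow_one, mul_comm]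
            congr 2
            field_simp
    · have : φ x = 0 := image_eq_zero_of_notMem_tsupport fun hx' => hx (h.2.2 hx')
      simp [this, hp0]
  rw [eLpNorm_eq_lintegral_rpow_enorm_toReal hne ENNReal.ofReal_ne_top,
    eLpNorm_eq_lintegral_rpow_enorm_toReal hne ENNReal.ofReal_ne_top, hpr]
  have hint : ∫⁻ x, ‖φ x‖ₑ ^ p ≤ ENNReal.ofReal T ^ p * ∫⁻ x, ‖gradient φ x‖ₑ ^ p := by
    calc ∫⁻ x, ‖φ x‖ₑ ^ p
        ≤ ∫⁻ x, ENNReal.ofReal T ^ (p - 1) *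
            ∫⁻ t in Ioc 0 T, ‖gradient φ (x + t • e)‖ₑ ^ p := lintegral_mono hpt
      _ = ENNReal.ofReal T ^ (p - 1) *
            ∫⁻ x, ∫⁻ t in Ioc 0 T, ‖gradient φ (x + t • e)‖ₑ ^ p :=
          lintegral_const_mul' _ _ (ENNReal.rpow_ne_top_of_nonneg (by linarith)
            ENNReal.ofReal_ne_top)
      _ = ENNReal.ofReal T ^ (p - 1) *
            ∫⁻ t in Ioc 0 T, ∫⁻ x, ‖gradient φ (x + t • e)‖ₑ ^ p := by
          rw [lintegral_lintegral_swap hmeas.aemeasurable]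
      _ = ENNReal.ofReal T ^ (p - 1) * (ENNReal.ofReal T * ∫⁻ x, ‖gradient φ x‖ₑ ^ p) := by
          -- By translation invariance the inner integral does not depend on t, so the t-integral
          -- only contributes the length T.
          simp_rw [fun t : ℝ => lintegral_add_right_eq_self (μ := (volume : Measure (Euc N)))
            (fun x => ‖gradient φ x‖ₑ ^ p) (t • e)]
          simp [mul_comm]
      _ = ENNReal.ofReal T ^ p * ∫⁻ x, ‖gradient φ x‖ₑ ^ p := by
          rw [← mul_assoc]
          congr 1
          nth_rw 2 [← ENNReal.rpow_one (ENNReal.ofReal T)]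
          rw [← ENNReal.rpow_add_of_nonneg _ _ (by linarith) zero_le_one, sub_add_cancel]
  calc (∫⁻ x, ‖φ x‖ₑ ^ p) ^ (1 / p)
      ≤ (ENNReal.ofReal T ^ p * ∫⁻ x, ‖gradient φ x‖ₑ ^ p) ^ (1 / p) := by gcongr
    _ = _ := by
      rw [ENNReal.mul_rpow_of_nonneg _ _ (by positivity), ← ENNReal.rpow_mul,
        mul_one_div_cancel hp0.ne', ENNReal.rpow_one]

/-- By density of test functions, whose norms over Ω and over the whole space agree. -/
lemma MemW0WithGrad.eLpNorm_le {Ω : Set (Euc N)} {p : ℝ} {u : Euc N → ℝ} {G : Euc N → Euc N}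
    (h : MemW0WithGrad Ω p u G) (hp : 1 ≤ p) {e : Euc N} (he : ‖e‖ = 1) {T : ℝ} (hT : 0 ≤ T)
    (hout : ∀ x ∈ Ω, x + T • e ∉ Ω) :
    eLpNorm u (ENNReal.ofReal p) (volume.restrict Ω) ≤
      ENNReal.ofReal T * eLpNorm G (ENNReal.ofReal p) (volume.restrict Ω) := by
  obtain ⟨hu, hG, φ, hφ, hφu, hφG⟩ := h
  have hp1 : (1 : ℝ≥0∞) ≤ ENNReal.ofReal p := by simpa using hp
  set μ := (volume : Measure (Euc N)).restrict Ω
  set P := ENNReal.ofReal p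
  have hlim : Tendsto (fun n => eLpNorm (fun x => φ n x - u x) P μ + ENNReal.ofReal T *
      (eLpNorm (fun x => gradient (φ n) x - G x) P μ + eLpNorm G P μ)) atTop
      (𝓝 (0 + ENNReal.ofReal T * (0 + eLpNorm G P μ))) :=
    hφu.add (ENNReal.Tendsto.const_mul (hφG.add tendsto_const_nhds)
      (Or.inr ENNReal.ofReal_ne_top))
  rw [zero_add, zero_add] at hlim
  refine ge_of_tendsto' hlim fun n => ?_
  have hm := (hφ n).memLp P μ
  have hmG := (hφ n).memLp_gradient P μ
  have h1 : eLpNorm u P μ ≤ eLpNorm (fun x => φ n x - u x) P μ + eLpNorm (φ n) P μ := by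
    have h1' : u = φ n - (fun x => φ n x - u x) := by ext x; simp
    conv_lhs => rw [h1']
    rw [add_comm]
    exact eLpNorm_sub_le hm.1 (hm.1.sub hu.1) hp1
  have h2 : eLpNorm (fun x => gradient (φ n) x) P μ ≤
      eLpNorm (fun x => gradient (φ n) x - G x) P μ + eLpNorm G P μ := by
    have h2' : (fun x => gradient (φ n) x) = (fun x => gradient (φ n) x - G x) + G := by
      ext x; simp
    conv_lhs => rw [h2']
    exact eLpNorm_add_le (hmG.1.sub hG.1) hG.1 hp1
  have h3 : eLpNorm (φ n) P μ ≤ ENNReal.ofReal T * eLpNorm (fun x => gradient (φ n) x) P μ := by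
    rw [eLpNorm_restrict_eq_of_support_subset ((subset_tsupport _).trans (hφ n).2.2),
      eLpNorm_restrict_eq_of_support_subset (hφ n).support_gradient_subset]
    exact (hφ n).eLpNorm_le_eLpNorm_gradient he hT hout hp
  calc eLpNorm u P μ ≤ _ := h1
    _ ≤ _ := by gcongr; exact h3.trans (by gcongr)

end Poincare

/-! ### Energy identity and positivity of Λ. -/

section Energy

variable {α V : Type*} [MeasurableSpace α] {μ : Measure α} [NormedAddCommGroup V]
  [InnerProductSpace ℝ V]

lemma norm_rpow_sub_two_smul {p : ℝ} (hp : 1 < p) (v : V) :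
    ‖‖v‖ ^ (p - 2) • v‖ = ‖v‖ ^ (p - 1) := by
  rcases eq_or_ne v 0 with rfl | hv
  · simp [Real.zero_rpow (by linarith : p - 1 ≠ 0)]
  · rw [norm_smul, Real.norm_of_nonneg (by positivity), ← Real.rpow_add_one (by simpa using hv)]
    ring_nf

lemma norm_rpow_sub_two_mul_inner_self {p : ℝ} (hp : 1 < p) (v : V) :
    inner ℝ (‖v‖ ^ (p - 2) • v) v = ‖v‖ ^ p := by
  rcases eq_or_ne v 0 with rfl | hv
  · simp [Real.zero_rpow (by linarith : p ≠ 0)]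
  · have : 0 < ‖v‖ := by simpa using hv
    rw [real_inner_smul_left, real_inner_self_eq_norm_sq, ← Real.rpow_natCast, ← Real.rpow_add this]
    norm_num

/-- The flux |G|^{p-2} G has norm |G|^{p-1}, so it lies in the space of the conjugate exponent
p/(p-1). -/
lemma memLp_norm_rpow_smul {p : ℝ} (hp : 1 < p) {G : α → V}
    (hG : MemLp G (ENNReal.ofReal p) μ) :
    MemLp (fun x => ‖G x‖ ^ (p - 2) • G x) (ENNReal.ofReal p / ENNReal.ofReal (p - 1)) μ := by
  have h1 := hG.norm_rpow_div (ENNReal.ofReal (p - 1))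
  rw [ENNReal.toReal_ofReal (by linarith)] at h1
  refine h1.of_le (((hG.1.norm.aemeasurable.pow_const _).aestronglyMeasurable).smul hG.1)
    (ae_of_all _ fun x => ?_)
  rw [norm_rpow_sub_two_smul hp, Real.norm_of_nonneg (by positivity)]

lemma holderTriple_ofReal {p : ℝ} (hp : 1 < p) :
    (ENNReal.ofReal p / ENNReal.ofReal (p - 1)).HolderTriple (ENNReal.ofReal p) 1 := by
  refine ⟨?_⟩
  have hp0 : 0 < p := by linarith
  have hp1 : 0 < p - 1 := by linarith
  rw [← ENNReal.ofReal_div_of_pos hp1, ← ENNReal.ofReal_inv_of_pos (by positivity),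
    ← ENNReal.ofReal_inv_of_pos hp0, ← ENNReal.ofReal_add (by positivity) (by positivity)]
  simp only [inv_one]
  rw [← ENNReal.ofReal_one]
  congr 1
  field_simp
  ring

end Energy

/-- Testing the eigenvalue equation with the solution itself. -/
lemma SolvesPLaplace.energy_eq {Ω : Set (Euc N)} {p lam : ℝ} (hp : 1 < p) {u : Euc N → ℝ}
    (h : SolvesPLaplace Ω p lam u) : ∃ G : Euc N → Euc N, MemW0WithGrad Ω p u G ∧
      ∫ x in Ω, ‖G x‖ ^ p = lam * ∫ x in Ω, |u x| ^ p := by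
  obtain ⟨G, hW, hG⟩ := h
  refine ⟨G, hW, ?_⟩
  obtain ⟨hu, hGp, φ, hφ, hφu, hφG⟩ := hW
  have := holderTriple_ofReal hp
  -- The solution need not be a test function, so the equation is used for φ_n and both sides pass
  -- to the limit.
  have h1 := tendsto_integral_inner (memLp_norm_rpow_smul hp hGp) hGp
    (fun n => (hφ n).memLp_gradient _ _) hφG
  have h2 := (tendsto_integral_inner (memLp_norm_rpow_smul hp hu) hu
    (fun n => (hφ n).memLp _ _) hφu).const_mul lam
  simp only [norm_rpow_sub_two_mul_inner_self hp] at h1 h2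
  refine tendsto_nhds_unique (h1.congr fun n => ?_) h2
  have h3 := hG (φ n) (hφ n)
  simp only [real_inner_smul_left]
  rw [h3]
  congr 1
  refine integral_congr_ae (ae_of_all _ fun x => ?_)
  simp only [Real.norm_eq_abs, RCLike.inner_apply, conj_trivial]
  ring

/-- The energy identity and the normalisation give ‖G‖_p = λ_p^{1/p}, and the Poincaré inequality
becomes the claim. -/
lemma IsFirstEigenfunction.one_le {Ω : Set (Euc N)} (hΩ : IsOpen Ω) {p : ℝ} (hp : 1 < p)
    {u : Euc N → ℝ} (h : IsFirstEigenfunction Ω p u) {e : Euc N} (he : ‖e‖ = 1) {T : ℝ}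
    (hT : 0 ≤ T) (hout : ∀ x ∈ Ω, x + T • e ∉ Ω) :
    1 ≤ T * firstEigenvalue Ω p ^ (1 / p) := by
  obtain ⟨G, hW, hE⟩ := h.1.energy_eq hp
  have hp0 : 0 < p := by linarith
  have hu : ∫ x in Ω, |u x| ^ p = 1 := by
    rw [← h.2.2.2]
    exact setIntegral_congr_fun hΩ.measurableSet fun x hx => by
      simp only [abs_of_pos (h.2.2.1 x hx)]
  rw [hu, mul_one] at hE
  have hle := hW.eLpNorm_le hp.le he hT hout
  have hne : ENNReal.ofReal p ≠ 0 := by simpa using hp0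
  rw [hW.1.eLpNorm_eq_integral_rpow_norm hne ENNReal.ofReal_ne_top,
    hW.2.1.eLpNorm_eq_integral_rpow_norm hne ENNReal.ofReal_ne_top,
    ENNReal.toReal_ofReal hp0.le, hE] at hle
  simp only [Real.norm_eq_abs, hu, Real.one_rpow] at hle
  rw [← ENNReal.ofReal_mul hT] at hle
  -- `ENNReal.ofReal` truncates negative numbers to 0, which the bound 1 ≤ … excludes.
  have hpos : 0 ≤ T * firstEigenvalue Ω p ^ p⁻¹ := by
    by_contra! hneg
    rw [ENNReal.ofReal_of_nonpos hneg.le] at hle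
    simp at hle
  rw [one_div]
  exact (ENNReal.ofReal_le_ofReal_iff hpos).1 hle

lemma IsLimit.limit_pos (hN : 1 ≤ N) {Ω : Set (Euc N)} (hΩ : IsOpen Ω)
    (hΩb : Bornology.IsBounded Ω) {p : ℕ → ℝ} {u : ℕ → Euc N → ℝ} {Lam : ℝ}
    {uinf : Euc N → ℝ} {f : Measure (Euc N)} (h : IsLimit Ω p u Lam uinf f) : 0 < Lam := by
  set e : Euc N := EuclideanSpace.single ⟨0, hN⟩ 1 with he_def
  have he : ‖e‖ = 1 := by simp [he_def]
  obtain ⟨T, hT, hdist⟩ : ∃ T : ℝ, 0 < T ∧ ∀ x ∈ Ω, ∀ y ∈ Ω, dist x y < T :=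
    -- The added 1 makes T exceed every distance within Ω, so a shift by T along e leaves Ω.
    ⟨Metric.diam Ω + 1, by positivity, fun x hx y hy =>
      (Metric.dist_le_diam_of_mem hΩb hx hy).trans_lt (lt_add_one _)⟩
  have hout : ∀ x ∈ Ω, x + T • e ∉ Ω := by
    intro x hx hx'
    have := hdist x hx _ hx'
    rw [dist_self_add_right, norm_smul, he, mul_one, Real.norm_of_nonneg hT.le] at this
    exact lt_irrefl _ this
  have hev : ∀ᶠ k in atTop, 1 ≤ T * firstEigenvalue Ω (p k) ^ (1 / p k) := by
    filter_upwards [h.exponent_tendsto.eventually_gt_atTop 1] with k hk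
    exact (h.eigenfunction k).one_le hΩ hk he hT.le hout
  have := ge_of_tendsto (h.eigenvalue_tendsto.const_mul T) hev
  exact pos_of_mul_pos_right (by linarith) hT.le

/-! ### Nearest points and distance to the boundary. -/

/-- A measurable selection of nearest points in a compact set: parametrise the set by the Cantor
set and take the smallest minimising parameter. -/
lemma exists_measurable_nearest {E : Type*} [MetricSpace E] [MeasurableSpace E] [BorelSpace E]
    {K : Set E} (hK : IsCompact K) (hne : K.Nonempty) :
    ∃ T : E → E, Measurable T ∧ ∀ x, T x ∈ K ∧ Metric.infDist x K = dist x (T x) := by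
  have := hne.to_subtype
  have := isCompact_iff_compactSpace.1 hK
  obtain ⟨g₀, hg₀, hsurj⟩ := exists_nat_bool_continuous_surjective_of_compact K
  set g : cantorSet → E := fun t => (g₀ (cantorSetHomeomorphNatToBool t) : E) with hg_def
  have hg : Continuous g :=
    continuous_subtype_val.comp (hg₀.comp cantorSetHomeomorphNatToBool.continuous)
  have hgK : ∀ t, g t ∈ K := fun t => Subtype.coe_prop _
  have hgsurj : ∀ y ∈ K, ∃ t, g t = y := by
    intro y hy
    obtain ⟨b, hb⟩ := hsurj ⟨y, hy⟩
    exact ⟨cantorSetHomeomorphNatToBool.symm b, by simp [hg_def, hb]⟩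
  have : CompactSpace cantorSet := isCompact_iff_compactSpace.1 isCompact_cantorSet
  have hmin : ∀ x, ∃ t : cantorSet, Metric.infDist x K = dist x (g t) ∧
      ∀ t', Metric.infDist x K = dist x (g t') → t ≤ t' := by
    intro x
    have hcl : IsClosed {t | Metric.infDist x K = dist x (g t)} :=
      isClosed_eq continuous_const (continuous_const.dist hg)
    have hne' : {t | Metric.infDist x K = dist x (g t)}.Nonempty := by
      obtain ⟨y, hy, hxy⟩ := hK.exists_infDist_eq_dist hne x
      obtain ⟨t, rfl⟩ := hgsurj y hy
      exact ⟨t, hxy⟩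
    obtain ⟨t, ht⟩ := hcl.isCompact.exists_isLeast hne'
    exact ⟨t, ht.1, fun t' ht' => ht.2 ht'⟩
  choose s hs hs_min using hmin
  refine ⟨g ∘ s, hg.measurable.comp ?_, fun x => ⟨hgK _, hs x⟩⟩
  have hval : Measurable fun x => (s x : ℝ) := by
    refine measurable_of_Iic fun a => ?_
    set C : Set cantorSet := {t | (t : ℝ) ≤ a}
    have hC : IsCompact (g '' C) :=
      (isClosed_le continuous_subtype_val continuous_const).isCompact.image hg
    -- The selected parameter is at most a exactly when some point of g(C) is nearest, a closed
    -- condition on x. The empty case is separate because `Metric.infDist` to ∅ is 0, which would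
    -- make that condition always true.
    rcases C.eq_empty_or_nonempty with hCe | hCne
    · have : (fun x => (s x : ℝ)) ⁻¹' Iic a = ∅ := by
        ext x
        simp only [mem_preimage, mem_Iic, mem_empty_iff_false, iff_false]
        intro hx
        exact (hCe ▸ (show s x ∈ C from hx) : s x ∈ (∅ : Set cantorSet))
      rw [this]
      exact MeasurableSet.empty
    · have : (fun x => (s x : ℝ)) ⁻¹' Iic a =
          {x | Metric.infDist x (g '' C) ≤ Metric.infDist x K} := by
        ext x
        simp only [mem_preimage, mem_Iic, mem_ofPred_eq]
        constructor
        · intro hx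
          rw [hs x]
          exact Metric.infDist_le_dist_of_mem ⟨s x, hx, rfl⟩
        · intro hx
          obtain ⟨_, ⟨t, ht, rfl⟩, hxt⟩ := hC.exists_infDist_eq_dist (hCne.image g) x
          have h1 : Metric.infDist x K = dist x (g t) :=
            le_antisymm (Metric.infDist_le_dist_of_mem (hgK t)) (hxt ▸ hx)
          exact le_trans (hs_min x t h1) ht
      rw [this]
      exact (isClosed_le (Metric.continuous_infDist_pt _)
        (Metric.continuous_infDist_pt _)).measurableSet
  exact hval.subtype_mk

section Distance

variable {Ω : Set (Euc N)}

lemma frontier_subset_compl (hΩ : IsOpen Ω) : frontier Ω ⊆ Ωᶜ := by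
  rw [hΩ.frontier_eq]
  exact fun x hx => hx.2

lemma ne_univ_of_isBounded (hN : 1 ≤ N) (hΩb : Bornology.IsBounded Ω) : Ω ≠ univ := by
  rintro rfl
  have : Nonempty (Fin N) := ⟨⟨0, hN⟩⟩
  exact NormedSpace.unbounded_univ ℝ (Euc N) hΩb

lemma exists_mem_frontier_infDist (hN : 1 ≤ N) (hΩb : Bornology.IsBounded Ω)
    {x : Euc N} (hx : x ∈ Ω) : ∃ y ∈ frontier Ω, Metric.infDist x Ωᶜ = dist x y :=
  exists_mem_frontier_infDist_compl_eq_dist hx (ne_univ_of_isBounded hN hΩb)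

/-- For x in Ω a nearest point of the complement lies on the boundary. The distance to Ωᶜ is
preferred because it also vanishes outside Ω, which makes it compactly supported. -/
lemma infDist_frontier_eq (hN : 1 ≤ N) (hΩ : IsOpen Ω) (hΩb : Bornology.IsBounded Ω)
    {x : Euc N} (hx : x ∈ closure Ω) :
    Metric.infDist x (frontier Ω) = Metric.infDist x Ωᶜ := by
  by_cases hxΩ : x ∈ Ω
  · obtain ⟨y, hy, hxy⟩ := exists_mem_frontier_infDist hN hΩb hxΩ
    refine le_antisymm ?_ (Metric.infDist_le_infDist_of_subset (frontier_subset_compl hΩ) ⟨y, hy⟩)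
    rw [hxy]
    exact Metric.infDist_le_dist_of_mem hy
  · rw [Metric.infDist_zero_of_mem (show x ∈ Ωᶜ from hxΩ), Metric.infDist_zero_of_mem]
    rw [hΩ.frontier_eq]
    exact ⟨hx, hxΩ⟩

end Distance

/-! ### Gradient bounds and the primal competitors. -/

section Lipschitz

/-- A Lipschitz function on a convex open set whose gradient is bounded by `Lam` almost everywhere
is `Lam`-Lipschitz. -/
lemma dist_le_of_ae_norm_gradient_le {U : Set (Euc N)} (hU : IsOpen U) (hconv : Convex ℝ U)
    {u : Euc N → ℝ} {K : NNReal} (hu : LipschitzOnWith K u U) {Lam : ℝ}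
    (hgrad : ∀ᵐ x ∂(volume.restrict U), ‖gradient u x‖ ≤ Lam) {x z : Euc N} (hx : x ∈ U)
    (hz : z ∈ U) : |u z - u x| ≤ Lam * ‖z - x‖ := by
  set v := z - x with hv
  have hae : ∀ᵐ w ∂(volume : Measure (Euc N)), w ∈ U →
      DifferentiableAt ℝ u w ∧ ‖gradient u w‖ ≤ Lam := by
    have h1 := hu.ae_differentiableWithinAt (μ := volume) hU.measurableSet
    rw [ae_restrict_iff' hU.measurableSet] at h1 hgrad
    filter_upwards [h1, hgrad] with w hw1 hw2 hwU
    exact ⟨(hw1 hwU).differentiableAt (hU.mem_nhds hwU), hw2 hwU⟩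
  obtain ⟨S, hS, hSm, hS0⟩ := exists_measurable_superset_of_null hae
  -- The bad null set may contain the whole segment [x, z]. By Fubini, almost every translate of the
  -- line through it meets the bad set in a null set of parameters.
  have hgood : ∀ᵐ h ∂(volume : Measure (Euc N)), ∀ᵐ t ∂(volume : Measure ℝ),
      x + h + t • v ∉ S := by
    refine (Measure.ae_ae_comm ?_).1 (ae_of_all _ fun t => ?_)
    · have : Measurable fun q : ℝ × Euc N => x + q.2 + q.1 • v := by fun_prop
      exact (this hSm).compl
    · have h1 : (fun h : Euc N => x + h + t • v) ⁻¹' S = (fun h => h + (x + t • v)) ⁻¹' S := by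
        congr 1; ext1 h; abel
      rw [ae_iff]
      simp only [not_not]
      change volume ((fun h : Euc N => x + h + t • v) ⁻¹' S) = 0
      rw [h1, measure_preimage_add_right, hS0]
  have hcx : Tendsto (fun h => x + h) (𝓝 (0 : Euc N)) (𝓝 x) := by
    simpa using (continuous_const_add x).tendsto (0 : Euc N)
  have hcz : Tendsto (fun h => z + h) (𝓝 (0 : Euc N)) (𝓝 z) := by
    simpa using (continuous_const_add z).tendsto (0 : Euc N)
  have hlim : Tendsto (fun h => |u (z + h) - u (x + h)|) (𝓝 0) (𝓝 |u z - u x|) :=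
    (((hu.continuousOn.continuousAt (hU.mem_nhds hz)).tendsto.comp hcz).sub
      ((hu.continuousOn.continuousAt (hU.mem_nhds hx)).tendsto.comp hcx)).abs
  -- Good translations h are dense, so it suffices to prove the bound for good h near 0 and let h →
  -- 0.
  refine le_of_tendsto_of_frequently hlim ?_
  have hfreq : ∃ᶠ h in 𝓝 (0 : Euc N), ∀ᵐ t ∂(volume : Measure ℝ), x + h + t • v ∉ S :=
    mem_closure_iff_frequently.1 ((Measure.dense_of_ae hgood) 0)
  refine (hfreq.and_eventually ((hcx.eventually (hU.mem_nhds hx)).and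
    (hcz.eventually (hU.mem_nhds hz)))).mono ?_
  rintro h ⟨hh, hxU, hzU⟩
  have hseg : ∀ t ∈ Icc (0 : ℝ) 1, x + h + t • v ∈ U := by
    intro t ht
    have := hconv.add_smul_sub_mem hxU hzU ht
    rwa [add_sub_add_right_eq_sub] at this
  set g : ℝ → ℝ := fun t => u (x + h + t • v)
  have hgL : LipschitzOnWith (K * ‖v‖₊) g (uIcc 0 1) := by
    rw [uIcc_of_le zero_le_one]
    refine hu.comp (g := u) (f := fun t : ℝ => x + h + t • v) ?_ hseg
    refine LipschitzWith.lipschitzOnWith (LipschitzWith.of_dist_le_mul fun a b => ?_)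
    rw [dist_add_left, dist_eq_norm, ← sub_smul, norm_smul, mul_comm, Real.dist_eq]
    simp
  have hftc := hgL.absolutelyContinuousOnInterval.integral_deriv_eq_sub
  have hg1 : g 1 = u (z + h) := by
    simp only [g, one_smul, hv]; congr 1; abel
  have hg0 : g 0 = u (x + h) := by simp [g]
  rw [hg1, hg0] at hftc
  rw [← hftc, ← Real.norm_eq_abs]
  have := intervalIntegral.norm_integral_le_of_norm_le_const_ae (a := 0) (b := 1)
    (f := deriv g) (C := Lam * ‖v‖) ?_
  · simpa using this
  · filter_upwards [hh] with t ht htI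
    rw [uIoc_of_le zero_le_one] at htI
    have htU := hseg t ⟨htI.1.le, htI.2⟩
    have hw : x + h + t • v ∈ U → DifferentiableAt ℝ u (x + h + t • v) ∧
        ‖gradient u (x + h + t • v)‖ ≤ Lam := by
      by_contra hcon
      exact ht (hS hcon)
    obtain ⟨hd, hb⟩ := hw htU
    have h1 : HasDerivAt (fun t : ℝ => x + h + t • v) v t := by
      simpa using ((hasDerivAt_id t).smul_const v).const_add (x + h)
    have h2 : HasDerivAt g (fderiv ℝ u (x + h + t • v) v) t :=
      hd.hasFDerivAt.comp_hasDerivAt t h1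
    rw [h2.deriv]
    refine (ContinuousLinearMap.le_opNorm _ _).trans ?_
    rw [← norm_gradient]
    gcongr

/-- Functions admissible in `(P_∞)` are bounded by `Lam` times the distance to the boundary. -/
lemma IsAdmissible.abs_le (hN : 1 ≤ N) {Ω : Set (Euc N)} (hΩ : IsOpen Ω)
    (hΩb : Bornology.IsBounded Ω) {Lam : ℝ} {u : Euc N → ℝ} (h : IsAdmissible Ω Lam u)
    {x : Euc N} (hx : x ∈ closure Ω) : |u x| ≤ Lam * Metric.infDist x Ωᶜ := by
  obtain ⟨⟨K, hK⟩, hgrad, hzero⟩ := h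
  by_cases hxΩ : x ∈ Ω
  swap
  · rw [hzero x (by rw [hΩ.frontier_eq]; exact ⟨hx, hxΩ⟩),
      Metric.infDist_zero_of_mem (show x ∈ Ωᶜ from hxΩ)]
    simp
  obtain ⟨y, hy, hxy⟩ := exists_mem_frontier_infDist hN hΩb hxΩ
  set r := Metric.infDist x Ωᶜ
  have hball : Metric.ball x r ⊆ Ω := by
    simpa using Metric.ball_infDist_compl_subset (s := Ω) (x := x)
  have hr : 0 < r := by
    rw [hxy, dist_pos]
    rintro rfl
    exact frontier_subset_compl hΩ hy hxΩ
  -- Ω need not be convex, but the ball of radius d(x) about x is convex and lies in Ω. The path c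
  -- stays in it for s < 1 and reaches the boundary point y only in the limit.
  set c : ℝ → Euc N := fun s => x + s • (y - x)
  have hc1 : c 1 = y := by simp [c]
  have hcont : Continuous c := by fun_prop
  have hcball : ∀ s ∈ Ico (0 : ℝ) 1, c s ∈ Metric.ball x r := by
    intro s hs
    rw [Metric.mem_ball, dist_self_add_left, norm_smul, Real.norm_of_nonneg hs.1,
      ← dist_eq_norm, dist_comm, ← hxy]
    nlinarith [hs.2]
  have hIco : Ico (0 : ℝ) 1 ∈ 𝓝[<] 1 := Ico_mem_nhdsLT zero_lt_one
  have hcc : Tendsto c (𝓝[<] 1) (𝓝[closure Ω] y) := by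
    rw [tendsto_nhdsWithin_iff]
    refine ⟨?_, ?_⟩
    · rw [← hc1]; exact (hcont.tendsto 1).mono_left nhdsWithin_le_nhds
    · filter_upwards [hIco] with s hs
      exact subset_closure (hball (hcball s hs))
  have hlim : Tendsto (fun s => |u (c s) - u x|) (𝓝[<] 1) (𝓝 |u y - u x|) :=
    (((hK.continuousOn y (frontier_subset_closure hy)).tendsto.comp hcc).sub_const _).abs
  have hle : |u y - u x| ≤ Lam * r := by
    have hLam : Tendsto (fun s => Lam * ‖c s - x‖) (𝓝[<] 1) (𝓝 (Lam * ‖y - x‖)) :=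
      (((tendsto_nhds_of_tendsto_nhdsWithin hcc).sub_const x).norm).const_mul Lam
    rw [hxy, dist_comm, dist_eq_norm]
    refine le_of_tendsto_of_tendsto hlim hLam ?_
    filter_upwards [hIco] with s hs
    exact dist_le_of_ae_norm_gradient_le Metric.isOpen_ball (convex_ball x r)
      (hK.mono (hball.trans subset_closure))
      (ae_mono (Measure.restrict_mono hball le_rfl) hgrad) (Metric.mem_ball_self hr) (hcball s hs)
  rwa [hzero y hy, zero_sub, abs_neg] at hle

/-- This is the extremal competitor in the primal problem. -/
lemma isAdmissible_infDist {Ω : Set (Euc N)} (hΩ : IsOpen Ω) {Lam : ℝ} (hLam : 0 ≤ Lam) :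
    IsAdmissible Ω Lam (fun x => Lam * Metric.infDist x Ωᶜ) := by
  have hL : LipschitzWith ⟨Lam, hLam⟩ (fun x : Euc N => Lam * Metric.infDist x Ωᶜ) := by
    refine LipschitzWith.of_dist_le_mul fun a b => ?_
    rw [Real.dist_eq, ← mul_sub, abs_mul, abs_of_nonneg hLam, ← Real.dist_eq]
    have := (Metric.lipschitz_infDist_pt (Ωᶜ)).dist_le_mul a b
    simp only [NNReal.coe_one, one_mul] at this
    exact mul_le_mul_of_nonneg_left this hLam
  refine ⟨⟨_, hL.lipschitzOnWith⟩, ae_of_all _ fun x => ?_, fun x hx => ?_⟩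
  · rw [norm_gradient]
    exact norm_fderiv_le_of_lipschitz ℝ hL
  · simp [Metric.infDist_zero_of_mem (frontier_subset_compl hΩ hx)]

end Lipschitz

/-! ### Integration against vector measures with a density. -/

section VectorIntegral

variable {X E F G : Type*} [MeasurableSpace X] {μ : Measure X}
  [NormedAddCommGroup E] [NormedSpace ℝ E] [NormedAddCommGroup F] [NormedSpace ℝ F]
  [NormedAddCommGroup G] [NormedSpace ℝ G]

lemma isFiniteMeasure_variation_withDensityᵥ [CompleteSpace F] {w : X → F} (hw : Integrable w μ) :
    IsFiniteMeasure (μ.withDensityᵥ w).variation := by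
  rw [Measure.variation_withDensityᵥ hw]
  exact ⟨by simpa using! hw.2⟩

lemma integrable_bilinear_of_bound (B : E →L[ℝ] F →L[ℝ] G) {w : X → F} (hw : Integrable w μ)
    {h : X → E} (hh : AEStronglyMeasurable h μ) {C : ℝ} (hC : ∀ x, ‖h x‖ ≤ C) :
    Integrable (fun x => B (h x) (w x)) μ := by
  refine (hw.norm.const_mul (‖B‖ * C)).mono' (B.aestronglyMeasurable_comp₂ hh hw.1)
    (ae_of_all _ fun x => ?_)
  refine (B.le_opNorm₂ _ _).trans ?_
  gcongr
  exact hC x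

/-- The integral of a bounded function against a vector measure with a density. -/
lemma integral_withDensityᵥ [CompleteSpace F] [CompleteSpace G] (B : E →L[ℝ] F →L[ℝ] G) {w : X → F} (hw : Integrable w μ)
    {h : X → E} (hh : StronglyMeasurable h) {C : ℝ} (hC : ∀ x, ‖h x‖ ≤ C) :
    (μ.withDensityᵥ w).integral h B = ∫ x, B (h x) (w x) ∂μ := by
  have hfin := isFiniteMeasure_variation_withDensityᵥ hw
  have hsimple : ∀ g : SimpleFunc X E,
      (μ.withDensityᵥ w).integral g B = ∫ x, B (g x) (w x) ∂μ := by
    intro g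
    induction g using SimpleFunc.induction with
    | @const c s hs =>
      have h1 : ⇑(SimpleFunc.piecewise s hs (SimpleFunc.const X c) (SimpleFunc.const X 0)) =
          s.indicator fun _ => c := by
        ext x; by_cases hx : x ∈ s <;> simp [hx]
      have h2 : ∀ x, B (s.indicator (fun _ => c) x) (w x) = s.indicator (fun x => B c (w x)) x := by
        intro x; by_cases hx : x ∈ s <;> simp [hx]
      rw [h1]
      simp_rw [h2]
      rw [VectorMeasure.integral_indicator hs, MeasureTheory.integral_indicator hs,
        ContinuousLinearMap.integral_comp_comm _ hw.integrableOn, ← withDensityᵥ_apply hw hs]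
      have := VectorMeasure.variation_restrict_le (μ := μ.withDensityᵥ w) (s := s)
      have : IsFiniteMeasure ((μ.withDensityᵥ w).restrict s).variation :=
        isFiniteMeasure_of_le _ this
      rw [VectorMeasure.integral_const]
      simp [VectorMeasure.restrict_apply _ hs]
    | @add f g _ hf hg =>
      obtain ⟨Cf, hCf⟩ := f.exists_forall_norm_le
      obtain ⟨Cg, hCg⟩ := g.exists_forall_norm_le
      rw [SimpleFunc.coe_add]
      have hfi : (μ.withDensityᵥ w).Integrable f := SimpleFunc.integrable_of_isFiniteMeasure f
      have hgi : (μ.withDensityᵥ w).Integrable g := SimpleFunc.integrable_of_isFiniteMeasure g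
      rw [VectorMeasure.integral_add hfi hgi, hf, hg, ← MeasureTheory.integral_add
        (integrable_bilinear_of_bound B hw f.stronglyMeasurable.aestronglyMeasurable hCf)
        (integrable_bilinear_of_bound B hw g.stronglyMeasurable.aestronglyMeasurable hCg)]
      simp
  -- A point of X is needed to deduce 0 ≤ C, which the bounded simple approximations require.
  rcases isEmpty_or_nonempty X with hX | ⟨⟨x₀⟩⟩
  · rw [VectorMeasure.integral_congr_ae (g := 0) (ae_of_all _ fun x => hX.elim x)]
    simp [Measure.eq_zero_of_isEmpty]
  have hC0 : 0 ≤ C := (norm_nonneg _).trans (hC x₀)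
  have h1 : Tendsto (fun n => (μ.withDensityᵥ w).integral (hh.approxBounded C n) B) atTop
      (𝓝 ((μ.withDensityᵥ w).integral h B)) :=
    VectorMeasure.tendsto_integral_of_dominated_convergence (fun _ => C)
    (fun n => (hh.approxBounded C n).stronglyMeasurable.aestronglyMeasurable)
    (integrable_const C) (fun n => ae_of_all _ fun x => hh.norm_approxBounded_le hC0 n x)
    (ae_of_all _ fun x => hh.tendsto_approxBounded_of_norm_le (hC x))
  simp_rw [hsimple] at h1
  refine tendsto_nhds_unique h1 ?_
  refine tendsto_integral_of_dominated_convergence (fun x => ‖B‖ * C * ‖w x‖)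
    (fun n => B.aestronglyMeasurable_comp₂
      (hh.approxBounded C n).stronglyMeasurable.aestronglyMeasurable hw.1)
    (hw.norm.const_mul _) (fun n => ae_of_all _ fun x => ?_) (ae_of_all _ fun x => ?_)
  · refine (B.le_opNorm₂ _ _).trans ?_
    gcongr
    exact hh.norm_approxBounded_le hC0 n x
  · exact ((B.flip (w x)).continuous.tendsto _).comp
      (hh.tendsto_approxBounded_of_norm_le (hC x))

end VectorIntegral

/-! ### The optimal flow along transport rays. -/

section TransportRays

/-- The vector measure that spreads `x - T x` uniformly along the segments `[x, T x]`. -/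
noncomputable def rayMeasure (f : Measure (Euc N)) (T : Euc N → Euc N) :
    VectorMeasure (Euc N) (Euc N) :=
  ((f.prod (volume.restrict (Ioc (0 : ℝ) 1))).withDensityᵥ fun z => z.1 - T z.1).map
    fun z => z.1 + z.2 • (T z.1 - z.1)

variable {f : Measure (Euc N)} {T : Euc N → Euc N}

lemma integrable_ray (hf : Integrable (fun x => x - T x) f) :
    Integrable (fun z : Euc N × ℝ => z.1 - T z.1) (f.prod (volume.restrict (Ioc (0 : ℝ) 1))) :=
  hf.comp_fst _

/-- Pushing forward cannot increase total variation, but rays could cancel, so only an inequality is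
immediate; weak duality later yields equality for the nearest-point map. -/
lemma variation_rayMeasure_le (hT : Measurable T) (hf : Integrable (fun x => x - T x) f) :
    (rayMeasure f T).variation univ ≤ ENNReal.ofReal (∫ x, ‖x - T x‖ ∂f) := by
  have hS : Measurable fun z : Euc N × ℝ => z.1 + z.2 • (T z.1 - z.1) := by fun_prop
  refine (VectorMeasure.variation_map_le univ).trans ?_
  rw [Measure.map_apply hS MeasurableSet.univ, preimage_univ,
    Measure.variation_withDensityᵥ (integrable_ray hf), withDensity_apply _ MeasurableSet.univ,
    Measure.restrict_univ, ofReal_integral_norm_eq_lintegral_enorm hf,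
    lintegral_prod _ (by fun_prop)]
  simp

/-- The fundamental theorem of calculus on one segment. The factor x - y, opposite to the direction
of travel, produces the sign in -div σ = f - ν. -/
lemma integral_gradient_segment {φ : Euc N → ℝ} (hφ : IsTestFunction univ φ) (x y : Euc N) :
    ∫ t in Ioc (0 : ℝ) 1, inner ℝ (gradient φ (x + t • (y - x))) (x - y) = φ x - φ y := by
  have hder : ∀ t : ℝ, HasDerivAt (fun t : ℝ => -φ (x + t • (y - x)))
      (inner ℝ (gradient φ (x + t • (y - x))) (x - y)) t := by
    intro t
    rw [inner_gradient_left]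
    have h1 : HasDerivAt (fun t : ℝ => x + t • (y - x)) (y - x) t := by
      simpa using ((hasDerivAt_id t).smul_const (y - x)).const_add x
    have h2 := (((hφ.1.differentiable (by simp)) (x + t • (y - x))).hasFDerivAt.comp_hasDerivAt
      t h1).neg
    rwa [← map_neg, neg_sub] at h2
  have hcont : Continuous fun t : ℝ => inner ℝ (gradient φ (x + t • (y - x))) (x - y) :=
    (hφ.continuous_gradient.comp (by fun_prop)).inner continuous_const
  have hftc := intervalIntegral.integral_eq_sub_of_hasDerivAt (a := 0) (b := 1)
    (fun t _ => hder t) (hcont.intervalIntegrable _ _)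
  rw [← intervalIntegral.integral_of_le zero_le_one, hftc]
  simp
  ring

lemma IsTestFunction.exists_norm_gradient_le {Ω : Set (Euc N)} {φ : Euc N → ℝ}
    (h : IsTestFunction Ω φ) : ∃ C, ∀ x, ‖gradient φ x‖ ≤ C :=
  h.hasCompactSupport_gradient.exists_bound_of_continuous h.continuous_gradient

lemma negDivEq_rayMeasure [IsFiniteMeasure f] (hT : Measurable T) (hf : Integrable (fun x => x - T x) f) :
    NegDivEq (rayMeasure f T) f (f.map T) := by
  intro φ hφ
  have hS : Measurable fun z : Euc N × ℝ => z.1 + z.2 • (T z.1 - z.1) := by fun_prop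
  have hfin := isFiniteMeasure_variation_withDensityᵥ (integrable_ray hf)
  obtain ⟨C, hC⟩ := hφ.exists_norm_gradient_le
  have hm : StronglyMeasurable fun z : Euc N × ℝ => gradient φ (z.1 + z.2 • (T z.1 - z.1)) :=
    hφ.continuous_gradient.stronglyMeasurable.comp_measurable hS
  rw [rayMeasure, VectorMeasure.integral_map hS hφ.continuous_gradient.aestronglyMeasurable
    (Integrable.of_bound hm.aestronglyMeasurable C (ae_of_all _ fun z => hC _)),
    integral_withDensityᵥ (innerSL ℝ) (integrable_ray hf) hm (fun z => hC _),
    integral_prod _ (integrable_bilinear_of_bound (innerSL ℝ) (integrable_ray hf)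
      hm.aestronglyMeasurable (fun z => hC _))]
  refine (integral_congr_ae (ae_of_all _ fun x => integral_gradient_segment hφ x (T x))).trans ?_
  rw [integral_map hT.aemeasurable hφ.1.continuous.aestronglyMeasurable]
  obtain ⟨D, hD⟩ := hφ.2.1.exists_bound_of_continuous hφ.1.continuous
  exact integral_sub
    (Integrable.of_bound hφ.1.continuous.aestronglyMeasurable D (ae_of_all _ hD))
    (Integrable.of_bound (hφ.1.continuous.measurable.comp hT).aestronglyMeasurable D
      (ae_of_all _ fun x => hD _))

end TransportRays

/-! ### Weak duality with Lipschitz test functions. -/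

section WeakDuality

/-- Mollification of a compactly supported `1`-Lipschitz function. -/
lemma exists_testFunction_dist_le {v : Euc N → ℝ} (hv : LipschitzWith 1 v)
    (hvc : HasCompactSupport v) {ε : ℝ} (hε : 0 < ε) :
    ∃ φ : Euc N → ℝ, IsTestFunction univ φ ∧ (∀ x, ‖gradient φ x‖ ≤ 1) ∧
      ∀ x, |φ x - v x| ≤ ε := by
  -- Only the outer radius ε matters: averaging a 1-Lipschitz function over distances below ε moves
  -- it by at most ε.
  let b : ContDiffBump (0 : Euc N) := ⟨ε / 2, ε, by positivity, by linarith⟩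
  set ρ := b.normed volume with hρ
  have hρi : Integrable ρ volume := b.integrable_normed
  set φ := convolution ρ v (ContinuousLinearMap.lsmul ℝ ℝ) volume with hφ
  have hcs : HasCompactSupport φ :=
    HasCompactSupport.convolution _ b.hasCompactSupport_normed hvc
  have hsm : ContDiff ℝ ∞ φ := b.hasCompactSupport_normed.contDiff_convolution_left _
    b.contDiff_normed hv.continuous.locallyIntegrable
  obtain ⟨D, hD⟩ := hvc.exists_bound_of_continuous hv.continuous
  have hint : ∀ x, Integrable (fun t => ρ t * v (x - t)) volume := fun x =>
    hρi.mul_bdd (c := D) (hv.continuous.comp (by fun_prop)).aestronglyMeasurable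
      (ae_of_all _ fun t => hD _)
  have hφx : ∀ x, φ x = ∫ t, ρ t * v (x - t) := fun x => rfl
  have hL : LipschitzWith 1 φ := by
    refine LipschitzWith.of_dist_le_mul fun x y => ?_
    rw [NNReal.coe_one, one_mul, dist_eq_norm, hφx, hφx, ← integral_sub (hint x) (hint y)]
    calc ‖∫ t, (ρ t * v (x - t) - ρ t * v (y - t))‖ ≤ ∫ t, ρ t * dist x y := by
          refine norm_integral_le_of_norm_le (hρi.mul_const _) (ae_of_all _ fun t => ?_)
          rw [← mul_sub, norm_mul, Real.norm_of_nonneg (b.nonneg_normed t), ← dist_eq_norm]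
          have := hv.dist_le_mul (x - t) (y - t)
          rw [dist_sub_right, NNReal.coe_one, one_mul] at this
          exact mul_le_mul_of_nonneg_left this (b.nonneg_normed t)
      _ = dist x y := by rw [integral_mul_const, b.integral_normed, one_mul]
  refine ⟨φ, ⟨hsm, hcs, subset_univ _⟩, fun x => ?_, fun x => ?_⟩
  · rw [norm_gradient]
    simpa using norm_fderiv_le_of_lipschitz ℝ hL
  · rw [← Real.dist_eq]
    refine b.dist_normed_convolution_le hv.continuous.aestronglyMeasurable fun y hy => ?_
    have := hv.dist_le_mul y x
    rw [NNReal.coe_one, one_mul] at this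
    exact this.trans (Metric.mem_ball.1 hy).le

/-- A mollification φ has |∇φ| ≤ 1, so the equation bounds its pairing by the mass of σ. Replacing φ
by v costs at most δ/2 for each of the two probability measures. -/
lemma NegDivEq.sub_le_variation {σ : VectorMeasure (Euc N) (Euc N)} {f ν : Measure (Euc N)}
    [IsProbabilityMeasure f] [IsProbabilityMeasure ν] (h : NegDivEq σ f ν)
    (hσ : σ.variation univ ≠ ⊤) {v : Euc N → ℝ} (hv : LipschitzWith 1 v)
    (hvc : HasCompactSupport v) :
    ∫ x, v x ∂f - ∫ x, v x ∂ν ≤ (σ.variation univ).toReal := by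
  have hfin : IsFiniteMeasure σ.variation := ⟨hσ.lt_top⟩
  refine le_of_forall_pos_le_add fun δ hδ => ?_
  obtain ⟨φ, hφ, hgrad, hdist⟩ := exists_testFunction_dist_le hv hvc (half_pos hδ)
  have h1 := h φ hφ
  have h2 := VectorMeasure.norm_integral_le_of_norm_le_const (μ := σ) (B := innerSL ℝ)
    (f := fun x => gradient φ x) (C := 1) (ae_of_all _ hgrad)
  have h3 : ‖(innerSL ℝ : Euc N →L[ℝ] Euc N →L[ℝ] ℝ)‖ ≤ 1 := norm_innerSL_le ℝ
  have h4 : ∫ x, φ x ∂f - ∫ x, φ x ∂ν ≤ (σ.variation univ).toReal := by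
    rw [← h1]
    refine (le_abs_self _).trans (h2.trans ?_)
    rw [one_mul]
    exact mul_le_of_le_one_left ENNReal.toReal_nonneg h3
  have hclose : ∀ (m : Measure (Euc N)) [IsProbabilityMeasure m],
      |∫ x, φ x ∂m - ∫ x, v x ∂m| ≤ δ / 2 := by
    intro m _
    rw [← integral_sub (hφ.1.continuous.integrable_of_hasCompactSupport hφ.2.1)
      (hv.continuous.integrable_of_hasCompactSupport hvc)]
    simpa using norm_integral_le_of_norm_le_const (μ := m) (f := fun x => φ x - v x)
      (ae_of_all _ hdist)
  have h5 := abs_le.1 (hclose f)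
  have h6 := abs_le.1 (hclose ν)
  linarith [h5.1, h6.2]

end WeakDuality

/-! ### The three optimal values. -/

variable {Ω : Set (Euc N)}

lemma restrict_closure_eq {f : Measure (Euc N)} (hf : f (closure Ω)ᶜ = 0) :
    f.restrict (closure Ω) = f :=
  Measure.restrict_eq_self_of_ae_mem ((measure_eq_zero_iff_ae_notMem.1 hf).mono
    fun _ hx => not_not.1 hx)

lemma integrable_of_continuousOn_closure (hΩb : Bornology.IsBounded Ω) {f : Measure (Euc N)}
    [IsFiniteMeasure f] (hf : f (closure Ω)ᶜ = 0) {g : Euc N → ℝ}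
    (hg : ContinuousOn g (closure Ω)) : Integrable g f := by
  have h := hg.integrableOn_compact (μ := f) hΩb.isCompact_closure
  rwa [IntegrableOn, restrict_closure_eq hf] at h

lemma integrable_infDist (hΩb : Bornology.IsBounded Ω) {f : Measure (Euc N)} [IsFiniteMeasure f]
    (hf : f (closure Ω)ᶜ = 0) (S : Set (Euc N)) : Integrable (fun x => Metric.infDist x S) f :=
  integrable_of_continuousOn_closure hΩb hf (Metric.continuous_infDist_pt S).continuousOn

lemma isLeast_primalValues (hN : 1 ≤ N) (hΩ : IsOpen Ω) (hΩb : Bornology.IsBounded Ω)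
    {f : Measure (Euc N)} [IsFiniteMeasure f] (hf : f (closure Ω)ᶜ = 0) {Lam : ℝ}
    (hLam : 0 ≤ Lam) :
    IsLeast (primalValues Ω Lam f) (-(Lam * ∫ x, Metric.infDist x Ωᶜ ∂f)) := by
  constructor
  · refine ⟨_, isAdmissible_infDist hΩ hLam, ?_⟩
    rw [restrict_closure_eq hf, integral_const_mul]
  · rintro _ ⟨u, hu, rfl⟩
    rw [neg_le_neg_iff, ← integral_const_mul]
    obtain ⟨K, hK⟩ := hu.1
    rw [restrict_closure_eq hf]
    refine integral_mono_ae (integrable_of_continuousOn_closure hΩb hf hK.continuousOn)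
      ((integrable_infDist hΩb hf _).const_mul _) ?_
    filter_upwards [measure_eq_zero_iff_ae_notMem.1 hf] with x hx
    exact (le_abs_self _).trans (hu.abs_le hN hΩ hΩb (not_not.1 hx))

/-- A measurable nearest point map onto the boundary. -/
lemma exists_projection_frontier (hN : 1 ≤ N) (hΩ : IsOpen Ω) (hΩb : Bornology.IsBounded Ω)
    (hne : Ω.Nonempty) : ∃ T : Euc N → Euc N, Measurable T ∧ (∀ x, T x ∈ frontier Ω) ∧
      ∀ x ∈ closure Ω, ‖x - T x‖ = Metric.infDist x Ωᶜ := by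
  have hcomp : IsCompact (frontier Ω) :=
    hΩb.isCompact_closure.of_isClosed_subset isClosed_frontier frontier_subset_closure
  obtain ⟨x, hx⟩ := hne
  obtain ⟨y, hy, -⟩ := exists_mem_frontier_infDist hN hΩb hx
  obtain ⟨T, hT, hTK⟩ := exists_measurable_nearest hcomp ⟨y, hy⟩
  refine ⟨T, hT, fun x => (hTK x).1, fun x hx => ?_⟩
  rw [← infDist_frontier_eq hN hΩ hΩb hx, (hTK x).2, dist_eq_norm]

lemma map_mem_probOn {f : Measure (Euc N)} [IsProbabilityMeasure f] {T : Euc N → Euc N}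
    (hT : Measurable T) (hTK : ∀ x, T x ∈ frontier Ω) : f.map T ∈ ProbOn (frontier Ω) := by
  refine ⟨Measure.isProbabilityMeasure_map hT.aemeasurable, ?_⟩
  rw [Measure.map_apply hT isClosed_frontier.measurableSet.compl]
  have : T ⁻¹' (frontier Ω)ᶜ = ∅ := by
    ext x; simpa using hTK x
  rw [this, measure_empty]

lemma integral_norm_sub_projection {f : Measure (Euc N)} (hf : f (closure Ω)ᶜ = 0)
    {T : Euc N → Euc N} (hd : ∀ x ∈ closure Ω, ‖x - T x‖ = Metric.infDist x Ωᶜ) :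
    ∫ x, ‖x - T x‖ ∂f = ∫ x, Metric.infDist x Ωᶜ ∂f := by
  refine integral_congr_ae ?_
  filter_upwards [measure_eq_zero_iff_ae_notMem.1 hf] with x hx using hd x (not_not.1 hx)

lemma integrable_sub_projection (hΩb : Bornology.IsBounded Ω) {f : Measure (Euc N)}
    [IsFiniteMeasure f] (hf : f (closure Ω)ᶜ = 0) {T : Euc N → Euc N} (hT : Measurable T)
    (hd : ∀ x ∈ closure Ω, ‖x - T x‖ = Metric.infDist x Ωᶜ) :
    Integrable (fun x => x - T x) f := by
  refine (integrable_infDist hΩb hf Ωᶜ).mono' (by fun_prop) ?_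
  filter_upwards [measure_eq_zero_iff_ae_notMem.1 hf] with x hx
  exact (hd x (not_not.1 hx)).le

lemma integral_infDist_eq_zero (hΩ : IsOpen Ω) {ν : Measure (Euc N)}
    (hν : ν (frontier Ω)ᶜ = 0) : ∫ x, Metric.infDist x Ωᶜ ∂ν = 0 := by
  refine integral_eq_zero_of_ae ?_
  filter_upwards [measure_eq_zero_iff_ae_notMem.1 hν] with x hx
  exact Metric.infDist_zero_of_mem (frontier_subset_compl hΩ (not_not.1 hx))

lemma isLeast_dualValues (hN : 1 ≤ N) (hΩ : IsOpen Ω) (hΩb : Bornology.IsBounded Ω)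
    (hne : Ω.Nonempty) {f : Measure (Euc N)} [IsProbabilityMeasure f]
    (hf : f (closure Ω)ᶜ = 0) {Lam : ℝ} (hLam : 0 ≤ Lam) :
    IsLeast (dualValues Ω Lam f) (Lam * ∫ x, Metric.infDist x Ωᶜ ∂f) := by
  have hlow : ∀ ν ∈ ProbOn (frontier Ω), ∀ σ : VectorMeasure (Euc N) (Euc N),
      σ.variation univ ≠ ⊤ → NegDivEq σ f ν →
      ∫ x, Metric.infDist x Ωᶜ ∂f ≤ (σ.variation univ).toReal := by
    rintro ν ⟨hνp, hν⟩ σ hσ h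
    have hvc : HasCompactSupport fun x => Metric.infDist x Ωᶜ := by
      refine HasCompactSupport.intro hΩb.isCompact_closure fun x hx => ?_
      exact Metric.infDist_zero_of_mem fun hxΩ => hx (subset_closure hxΩ)
    have := h.sub_le_variation hσ (Metric.lipschitz_infDist_pt Ωᶜ) hvc
    rwa [integral_infDist_eq_zero hΩ hν, sub_zero] at this
  constructor
  · obtain ⟨T, hT, hTK, hd⟩ := exists_projection_frontier hN hΩ hΩb hne
    have hi := integrable_sub_projection hΩb hf hT hd
    have hle := variation_rayMeasure_le hT hi
    have hfin : (rayMeasure f T).variation univ ≠ ⊤ := (hle.trans_lt ENNReal.ofReal_lt_top).ne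
    refine ⟨f.map T, map_mem_probOn hT hTK, rayMeasure f T, hfin, negDivEq_rayMeasure hT hi, ?_⟩
    congr 1
    -- The mass of the ray measure is at most ∫ |x - T x| df = ∫ d df, while `hlow` gives the
    -- reverse bound.
    refine le_antisymm (hlow _ (map_mem_probOn hT hTK) _ hfin (negDivEq_rayMeasure hT hi)) ?_
    rw [← integral_norm_sub_projection hf hd]
    exact ENNReal.toReal_le_of_le_ofReal (integral_nonneg fun _ => norm_nonneg _) hle
  · rintro _ ⟨ν, hν, σ, hσ, h, rfl⟩
    exact mul_le_mul_of_nonneg_left (hlow ν hν σ hσ h) hLam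

lemma restrict_prod_closure_eq {f ν : Measure (Euc N)} (hf : f (closure Ω)ᶜ = 0)
    (hν : ν (closure Ω)ᶜ = 0) {γ : Measure (Euc N × Euc N)} (h₁ : γ.map Prod.fst = f)
    (h₂ : γ.map Prod.snd = ν) : γ.restrict (closure Ω ×ˢ closure Ω) = γ := by
  refine Measure.restrict_eq_self_of_ae_mem ?_
  have hm : MeasurableSet (closure Ω)ᶜ := isClosed_closure.measurableSet.compl
  rw [← h₁, Measure.map_apply measurable_fst hm] at hf
  rw [← h₂, Measure.map_apply measurable_snd hm] at hν
  filter_upwards [measure_eq_zero_iff_ae_notMem.1 hf, measure_eq_zero_iff_ae_notMem.1 hν] with z h h'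
  exact ⟨not_not.1 h, not_not.1 h'⟩

/-- The graph of the nearest-point map is optimal: under any competing plan the second coordinate
almost surely lies in Ωᶜ, so the cost is at least the distance from the first coordinate to Ωᶜ. -/
lemma isLeast_kantorovichValues (hN : 1 ≤ N) (hΩ : IsOpen Ω) (hΩb : Bornology.IsBounded Ω)
    (hne : Ω.Nonempty) {f : Measure (Euc N)} [IsProbabilityMeasure f]
    (hf : f (closure Ω)ᶜ = 0) :
    IsLeast (kantorovichValues Ω f) (∫ x, Metric.infDist x Ωᶜ ∂f) := by
  have hcl : ∀ ν ∈ ProbOn (frontier Ω), ν (closure Ω)ᶜ = 0 := fun ν hν =>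
    measure_mono_null (compl_subset_compl.2 frontier_subset_closure) hν.2
  constructor
  · obtain ⟨T, hT, hTK, hd⟩ := exists_projection_frontier hN hΩ hΩb hne
    have hm : Measurable fun x => (x, T x) := measurable_id.prodMk hT
    have h₁ : (f.map fun x => (x, T x)).map Prod.fst = f := by
      rw [Measure.map_map measurable_fst hm]
      exact Measure.map_id
    have h₂ : (f.map fun x => (x, T x)).map Prod.snd = f.map T := by
      rw [Measure.map_map measurable_snd hm]
      rfl
    have hT' := map_mem_probOn (f := f) hT hTK
    refine ⟨_, h₁, h₂ ▸ hT', ?_⟩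
    rw [restrict_prod_closure_eq hf (hcl _ hT') h₁ h₂, integral_map hm.aemeasurable
      (by fun_prop), integral_norm_sub_projection hf hd]
  · rintro _ ⟨γ, h₁, h₂, rfl⟩
    have hres := restrict_prod_closure_eq hf (hcl _ h₂) h₁ rfl
    have : IsFiniteMeasure γ := ⟨by
      have := congrArg (fun m : Measure (Euc N) => m univ) h₁
      simp only [Measure.map_apply measurable_fst MeasurableSet.univ, preimage_univ] at this
      rw [this]
      exact measure_lt_top _ _⟩
    have hint : Integrable (fun z : Euc N × Euc N => ‖z.1 - z.2‖) γ := by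
      have := (continuous_norm.comp (continuous_fst.sub continuous_snd)).continuousOn
        |>.integrableOn_compact (μ := γ)
          (hΩb.isCompact_closure.prod hΩb.isCompact_closure)
      rwa [IntegrableOn, hres] at this
    have hsnd : ∀ᵐ z ∂γ, z.2 ∈ frontier Ω := by
      have h := h₂.2
      rw [Measure.map_apply measurable_snd isClosed_frontier.measurableSet.compl] at h
      exact (measure_eq_zero_iff_ae_notMem.1 h).mono fun z hz => not_not.1 hz
    have hdi : Integrable (fun z : Euc N × Euc N => Metric.infDist z.1 Ωᶜ) γ := by
      have h := integrable_infDist hΩb hf Ωᶜ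
      rw [← h₁] at h
      exact h.comp_measurable measurable_fst
    rw [hres]
    calc ∫ x, Metric.infDist x Ωᶜ ∂f = ∫ z, Metric.infDist z.1 Ωᶜ ∂γ := by
          nth_rw 1 [← h₁]
          exact integral_map measurable_fst.aemeasurable
            (Metric.continuous_infDist_pt _).aestronglyMeasurable
      _ ≤ ∫ z, ‖z.1 - z.2‖ ∂γ := by
          refine integral_mono_ae hdi hint (hsnd.mono fun z hz => ?_)
          simp only [← dist_eq_norm]
          exact Metric.infDist_le_dist_of_mem (frontier_subset_compl hΩ hz)

/-- A nonempty Ω has a nonempty boundary, without which there is nothing to project onto. -/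
lemma IsFirstEigenfunction.nonempty {p : ℝ} {u : Euc N → ℝ} (h : IsFirstEigenfunction Ω p u) :
    Ω.Nonempty := by
  by_contra hne
  have := h.2.2.2
  rw [not_nonempty_iff_eq_empty.1 hne] at this
  simp at this

end InftyEigenvalue

theorem mainTheorem7 {N : ℕ} (hN : 1 ≤ N) (Ω : Set (InftyEigenvalue.Euc N))
    (hΩ : IsOpen Ω) (hΩb : Bornology.IsBounded Ω)
    (p : ℕ → ℝ) (u : ℕ → InftyEigenvalue.Euc N → ℝ)
    (Lam : ℝ) (uinf : InftyEigenvalue.Euc N → ℝ) (f : Measure (InftyEigenvalue.Euc N))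
    (hlim : InftyEigenvalue.IsLimit Ω p u Lam uinf f) :
    0 < Lam ∧ ∃ m mstar : ℝ,
      IsLeast (InftyEigenvalue.primalValues Ω Lam f) m ∧
      IsLeast (InftyEigenvalue.dualValues Ω Lam f) mstar ∧
      IsGLB (InftyEigenvalue.kantorovichValues Ω f) (-(1 / Lam) * m) ∧
      -(1 / Lam) * m = (1 / Lam) * mstar := by
  have hLam := hlim.limit_pos hN hΩ hΩb
  have hprob := hlim.isProbabilityMeasure hΩ hΩb
  have hne := (hlim.eigenfunction 0).nonempty
  have hK := (InftyEigenvalue.isLeast_kantorovichValues hN hΩ hΩb hne hlim.concentrated).isGLB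
  refine ⟨hLam, _, _,
    InftyEigenvalue.isLeast_primalValues hN hΩ hΩb hlim.concentrated hLam.le,
    InftyEigenvalue.isLeast_dualValues hN hΩ hΩb hne hlim.concentrated hLam.le, ?_, by ring⟩
  rwa [neg_mul_neg, one_div, inv_mul_cancel_left₀ hLam.ne']
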